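/- Let $p,q\ge 1$ and let $\mu=(\mu_{b,a})_{1\le b\le q,\,1\le a\le p}$ be a matrix of (positive, signed or complex) Borel measures on $\mathbb R$ with finite absolute moments of all orders; let $\Delta$ be the union of the closed supports of the $\mu_{b,a}$. With $X_{[m]}(x)=(I_m,\,xI_m,\,x^2I_m,\dots)^{\top}$, suppose that the moment matrix $\mathscr M=\int X_{[q]}\,d\mu\,X_{[p]}^{\top}$ has a Gauss–Borel factorization $\mathscr M=S^{-1}H\bar S^{-\top}$ with $S,\bar S$ lower unitriangular and $H$ diagonal and invertible. Put $B=S X_{[q]}$, with rows $B_n=(B_n^{(1)},\dots,B_n^{(q)})$, $n\ge 0$, and $D_n(z)=\int B_n(t)\,\frac{d\mu(t)}{z-t}$ (a row vector of length $p$). Let $R(x)=\sum_{l=0}^N R_l x^l$ with $R_l\in\mathbb C^{p\times p}$, $N\ge 1$, and, for some $r\in\{0,\dots,p-1\}$, $$R_N=\begin{bmatrix}0_{(p-r)\times r}&t_N\\0_{r\times r}&0_{r\times(p-r)}\end{bmatrix},\qquad R_{N-1}=\begin{bmatrix}*&*\\t_{N-1}&*\end{bmatrix},$$ where $t_N$ (of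 size $(p-r)\times(p-r)$) and $t_{N-1}$ (of size $r\times r$) are upper triangular with nonzero determinant (for instance identity matrices). Assume that all zeros of $\det R$ are simple, let $x_1,\dots,x_M\in\mathbb C$ be these zeros, and assume that none of them lies in $\Delta$. Let $v_i^L\ne 0$ (row) and $v_i^R\neq0$ (column) satisfy $v_i^LR(x_i)=0$ and $R(x_i)v_i^R=0$, let $\xi_i$ be arbitrary column-vector functions with values in $\mathbb C^q$, and consider the Geronimus perturbation $$d\check\mu=d\mu\,R^{-1}+\sum_{i=1}^M\xi_i\,v_i^L\,\delta_{x_i}.$$ Define $$\mathbb D_n^{(i)}=D_n(x_i)v_i^R,\qquad \mathbb W_n^{(i)}=B_n(x_i)\,\xi_i(x_i)\,v_i^LR'(x_i)v_i^R,$$ $$\tau_n=\det\big(\mathbb D_{n-M+k}^{(i)}-\mathbb W_{n-M+k}^{(i)}\big)_{k,i=1}^{M},\qquad n\ge M-1.$$ **Theorem.** If the perturbed mixed multiple orthogonality exists, that is, if the moment matrix $\check{\mathscr M}=\int X_{[q]}\,d\check\mu\,X_{[p]}^{\top}$ also has a Gauss–Borel factorization $\check{\mathscr M}=\check S^{-1}\check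 H\check{\bar S}^{-\top}$ with $\check S,\check{\bar S}$ lower unitriangular and $\check H$ diagonal and invertible, then $\tau_n\neq 0$ for every $n\ge M-1$. -/

import Mathlib

open Polynomial MeasureTheory

noncomputable section

namespace MixedOP

/-- The entry in row `n` and column `j` of the matrix of monomials
`X_[r](x) = (I_r, x I_r, x² I_r, …)ᵀ` (rows and columns are numbered from `0`). -/
def monomialVec (r n : ℕ) (j : Fin r) : ℂ[X] :=
  if n % r = (j : ℕ) then X ^ (n / r) else 0

/-- All moments of all entries of the matrix of measures are (absolutely) finite. -/
def HasFiniteMoments {p q : ℕ} (μ : Fin q → Fin p → ComplexMeasure ℝ) : Prop :=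
  ∀ b a (k : ℕ), Integrable (fun t : ℝ => (t : ℂ) ^ k) (μ b a).variation

/-- `∫ f(t) dμ_{b,a}(t)`, for a function `f` on the complex plane and a matrix `μ` of complex
measures on the real line. -/
def integ {p q : ℕ} (μ : Fin q → Fin p → ComplexMeasure ℝ) (b : Fin q) (a : Fin p)
    (f : ℂ → ℂ) : ℂ :=
  (μ b a).integral (fun t : ℝ => f (t : ℂ)) (ContinuousLinearMap.mul ℝ ℂ)

/-- The moment matrix `∫ X_[q] dL X_[p]ᵀ` of a `q × p` matrix `L` of functionals
(`L b a f` stands for `∫ f dL_{b,a}`). -/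
def momentMatrix {p q : ℕ} (L : Fin q → Fin p → (ℂ → ℂ) → ℂ) : Matrix ℕ ℕ ℂ :=
  fun n m => ∑ b, ∑ a, L b a (fun z => (monomialVec q n b).eval z * (monomialVec p m a).eval z)

/-- A semi-infinite matrix that is lower triangular with ones on the diagonal. -/
def IsLowerUnitriangular (S : Matrix ℕ ℕ ℂ) : Prop :=
  (∀ n, S n n = 1) ∧ ∀ n m, n < m → S n m = 0

/-- The Gauss–Borel (`LU`) factorization `𝓜 = S⁻¹ H S̄⁻ᵀ` with `S`, `S̄` lower unitriangular and
`H` diagonal and invertible, written as `S 𝓜 S̄ᵀ = H`. As `S` and `S̄` are lower triangular, the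
sums below are the full matrix products. -/
structure IsGaussBorel (𝓜 : Matrix ℕ ℕ ℂ) (S : Matrix ℕ ℕ ℂ) (H : ℕ → ℂ)
    (Sbar : Matrix ℕ ℕ ℂ) : Prop where
  lower : IsLowerUnitriangular S
  lower_bar : IsLowerUnitriangular Sbar
  diag_ne_zero : ∀ n, H n ≠ 0
  factor : ∀ n m, (∑ k ∈ Finset.range (n + 1), ∑ l ∈ Finset.range (m + 1),
    S n k * 𝓜 k l * Sbar m l) = if n = m then H n else 0

/-- The mixed multiple orthogonality on the step line exists for the matrix of functionals `L`:
its moment matrix has a Gauss–Borel factorization. Then `B = S X_[q]` and `A = X_[p]ᵀ S̄ᵀ H⁻¹`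
satisfy the biorthogonality `∫ B dL A = I`. -/
def OrthogonalityExists {p q : ℕ} (L : Fin q → Fin p → (ℂ → ℂ) → ℂ) : Prop :=
  ∃ S H Sbar, IsGaussBorel (momentMatrix L) S H Sbar

/-- The entries `B_n^{(b)}` of the monic family `B = S X_[q]`. -/
def polyB (q : ℕ) (S : Matrix ℕ ℕ ℂ) (n : ℕ) (b : Fin q) : ℂ[X] :=
  ∑ k ∈ Finset.range (n + 1), C (S n k) * monomialVec q k b

/-- The entries `D_n^{(a)}(z) = ∑_b ∫ B_n^{(b)}(t) dμ_{b,a}(t) / (z - t)` of the Cauchy transform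
of `B`. -/
def cauchyD {p q : ℕ} (μ : Fin q → Fin p → ComplexMeasure ℝ) (S : Matrix ℕ ℕ ℂ)
    (n : ℕ) (a : Fin p) (z : ℂ) : ℂ :=
  ∑ b, integ μ b a (fun t => (polyB q S n b).eval t / (z - t))

/-- The value `R(z)` of a matrix polynomial. -/
def evalAt {p : ℕ} (R : Matrix (Fin p) (Fin p) ℂ[X]) (z : ℂ) : Matrix (Fin p) (Fin p) ℂ :=
  R.map (fun f => f.eval z)

/-- The value `R'(z)` of the derivative of a matrix polynomial. -/
def derivAt {p : ℕ} (R : Matrix (Fin p) (Fin p) ℂ[X]) (z : ℂ) : Matrix (Fin p) (Fin p) ℂ :=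
  R.map (fun f => (derivative f).eval z)

/-- `R(x) = ∑_{l ≤ N} R_l x^l` with leading and sub-leading coefficients of the block form
`R_N = [0, t_N; 0, 0]` and `R_{N-1} = [*, *; t_{N-1}, *]`, where the row blocks have sizes `p - r`
and `r`, the column blocks have sizes `r` and `p - r`, and `t_N` (of size `p - r`) and `t_{N-1}`
(of size `r`) are upper triangular with nonzero diagonal entries. With indices from `0`, the
`(k, l)` entry of `t_N` is the `(k, l + r)` entry of `R_N`, and the `(k, l)` entry of `t_{N-1}` is
the `(k + (p - r), l)` entry of `R_{N-1}`. -/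
structure HasLeadingForm {p : ℕ} (N r : ℕ) (R : Matrix (Fin p) (Fin p) ℂ[X]) : Prop where
  natDegree_le : ∀ i j, (R i j).natDegree ≤ N
  lead_left : ∀ i j : Fin p, (j : ℕ) < r → (R i j).coeff N = 0
  lead_bottom : ∀ i j : Fin p, p - r ≤ (i : ℕ) → (R i j).coeff N = 0
  lead_upper : ∀ i j : Fin p, (j : ℕ) < (i : ℕ) + r → (R i j).coeff N = 0
  lead_diag : ∀ i j : Fin p, (j : ℕ) = (i : ℕ) + r → (R i j).coeff N ≠ 0
  sub_upper : ∀ i j : Fin p, (j : ℕ) + (p - r) < (i : ℕ) → (R i j).coeff (N - 1) = 0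
  sub_diag : ∀ i j : Fin p, (j : ℕ) + (p - r) = (i : ℕ) → (R i j).coeff (N - 1) ≠ 0

/-- The entries of the Geronimus perturbation
`dμ̌ = dμ R⁻¹ + ∑_i ξ_i v_i^L δ_{x_i}` of `μ`, as functionals `f ↦ ∫ f dμ̌_{b,a}`. -/
def perturbed {p q M : ℕ} (μ : Fin q → Fin p → ComplexMeasure ℝ)
    (R : Matrix (Fin p) (Fin p) ℂ[X]) (x : Fin M → ℂ) (vL : Fin M → Fin p → ℂ)
    (ξ : Fin M → ℂ → Fin q → ℂ) (b : Fin q) (a : Fin p) (f : ℂ → ℂ) : ℂ :=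
  (∑ c, integ μ b c (fun t => f t * (evalAt R t)⁻¹ c a)) +
    ∑ i, f (x i) * ξ i (x i) b * vL i a

/-- `𝔻_n^{(i)} = ∑_a D_n^{(a)}(x_i) v_{i;a}^R`. -/
def bbD {p q M : ℕ} (μ : Fin q → Fin p → ComplexMeasure ℝ) (S : Matrix ℕ ℕ ℂ)
    (x : Fin M → ℂ) (vR : Fin M → Fin p → ℂ) (n : ℕ) (i : Fin M) : ℂ :=
  ∑ a, cauchyD μ S n a (x i) * vR i a

/-- `𝕎_n^{(i)} = ∑_b B_n^{(b)}(x_i) ξ_{i;b}(x_i) v_i^L R'(x_i) v_i^R`. -/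
def bbW {p q M : ℕ} (S : Matrix ℕ ℕ ℂ) (R : Matrix (Fin p) (Fin p) ℂ[X])
    (x : Fin M → ℂ) (vL vR : Fin M → Fin p → ℂ) (ξ : Fin M → ℂ → Fin q → ℂ)
    (n : ℕ) (i : Fin M) : ℂ :=
  ∑ b, (polyB q S n b).eval (x i) * ξ i (x i) b * (vL i ⬝ᵥ (derivAt R (x i)).mulVec (vR i))

/-- `τ_n`, `n ≥ M - 1`: the determinant whose rows are `𝔻_k - 𝕎_k` for
`k = n - M + 1, …, n` and whose columns correspond to the eigenvalues `x_1, …, x_M`. -/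
def tau {p q M : ℕ} (μ : Fin q → Fin p → ComplexMeasure ℝ) (S : Matrix ℕ ℕ ℂ)
    (R : Matrix (Fin p) (Fin p) ℂ[X]) (x : Fin M → ℂ) (vL vR : Fin M → Fin p → ℂ)
    (ξ : Fin M → ℂ → Fin q → ℂ) (n : ℕ) : ℂ :=
  Matrix.det (Matrix.of fun k i : Fin M =>
    bbD μ S x vR (n + 1 - M + k) i - bbW S R x vL vR ξ (n + 1 - M + k) i)

end MixedOP

end

namespace MixedOP

/-! ### Gauss–Borel factorizations -/

section

/-! Suppose `tau` vanishes at `n`. A left null vector `c` of its matrix gives a combination `Q` of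
`B_{n+1-M}, …, B_n`, and the aim is to show that `Q` is orthogonal, for the perturbed form, to every
column vector of order `< n + 1` on the step line.

Two families of column vectors are tested. On `R U` the factor `R⁻¹` cancels and the left null
vectors kill the point masses, so the perturbed form equals the original one
(`pairing_perturbedPoly_mulVec`); it vanishes on `Q` if `U` has order `< n + 1 - M`. On the
quotients `R(x) v_i^R / (x - x_i)` it takes the value `-(𝔻 - 𝕎)` at `B_k`
(`pairing_perturbedPoly_eigenQuotient`), so it vanishes on `Q` by the choice of `c`.

These families span everything needed (`HasLeadingForm.exists_eq_mulVec_add_sum`): the leading form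
of `R` makes multiplication by `R` raise the order by exactly `N p - r`, this number equals `M`, and
simplicity of the zeros lets the quotients interpolate arbitrary data at the `x_i`. The leading
principal minors of the perturbed moment matrix are nonzero, so `Q = 0`, and independence of the
`B_k` forces `c = 0`. -/

theorem IsLowerUnitriangular.det_submatrix {S : Matrix ℕ ℕ ℂ} (hS : IsLowerUnitriangular S)
    {m : ℕ} (c : ℕ) : (Matrix.of fun i j : Fin m => S (c + i) (c + j)).det = 1 := by
  rw [Matrix.det_of_isLowerTriangular]
  · simp [hS.1]
  · intro i j hij
    exact hS.2 _ _ (by simpa using hij)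

theorem IsLowerUnitriangular.sum_range {S : Matrix ℕ ℕ ℂ} (hS : IsLowerUnitriangular S)
    {i n : ℕ} (hi : i < n) (f : ℕ → ℂ) :
    ∑ k ∈ Finset.range n, S i k * f k = ∑ k ∈ Finset.range (i + 1), S i k * f k := by
  refine (Finset.sum_subset (Finset.range_subset_range.2 hi) fun k _ hk => ?_).symm
  rw [hS.2 i k (by simpa using hk), zero_mul]

variable {𝓜 S : Matrix ℕ ℕ ℂ} {H : ℕ → ℂ} {Sbar : Matrix ℕ ℕ ℂ}

theorem IsGaussBorel.sum_mul_sum_eq (h : IsGaussBorel 𝓜 S H Sbar) (n m : ℕ) :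
    ∑ l ∈ Finset.range (m + 1), Sbar m l * ∑ k ∈ Finset.range (n + 1), S n k * 𝓜 k l =
      if n = m then H n else 0 := by
  rw [← h.factor n m, Finset.sum_comm]
  refine Finset.sum_congr rfl fun l _ => ?_
  rw [Finset.mul_sum]
  exact Finset.sum_congr rfl fun k _ => by ring

/-- The rows of `S 𝓜` vanish to the left of the diagonal. -/
theorem IsGaussBorel.sum_row_eq_zero (h : IsGaussBorel 𝓜 S H Sbar) {n : ℕ} :
    ∀ l < n, ∑ k ∈ Finset.range (n + 1), S n k * 𝓜 k l = 0 := by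
  intro l
  induction l using Nat.strong_induction_on with
  | _ l ih =>
    intro hl
    -- In entry `(n, l)` of the factorization the earlier columns drop out by induction, and the
    -- last one carries the coefficient `Sbar l l = 1`.
    have h1 := h.sum_mul_sum_eq n l
    rw [if_neg hl.ne', Finset.sum_range_succ, h.lower_bar.1, one_mul,
      Finset.sum_eq_zero, zero_add] at h1
    · exact h1
    · intro j hj
      have hj' := Finset.mem_range.1 hj
      rw [ih j hj' (hj'.trans hl), mul_zero]

/-- The leading principal submatrices of a matrix with a Gauss–Borel factorization are
nonsingular. -/
theorem IsGaussBorel.eq_zero_of_sum_eq_zero (h : IsGaussBorel 𝓜 S H Sbar) {n : ℕ} {v : ℕ → ℂ}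
    (hv : ∀ m < n, ∑ k ∈ Finset.range n, v k * 𝓜 k m = 0) : ∀ k < n, v k = 0 := by
  set A : Matrix (Fin n) (Fin n) ℂ := Matrix.of fun i j => S i j
  set B : Matrix (Fin n) (Fin n) ℂ := Matrix.of fun i j => 𝓜 i j
  set D : Matrix (Fin n) (Fin n) ℂ := Matrix.of fun i j => Sbar i j
  -- Triangularity of `S` and `Sbar` lets the factorization restrict to leading `n × n` blocks.
  have hprod : A * B * D.transpose = Matrix.diagonal fun i : Fin n => H i := by
    ext i j
    rw [Matrix.mul_apply, Matrix.diagonal_apply]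
    simp only [Matrix.mul_apply, Matrix.transpose_apply, A, B, D, Matrix.of_apply]
    have inner : ∀ l, ∑ k : Fin n, S i k * 𝓜 k l =
        ∑ k ∈ Finset.range ((i : ℕ) + 1), S i k * 𝓜 k l := fun l => by
      rw [Fin.sum_univ_eq_sum_range (fun k => S i k * 𝓜 k l) n, h.lower.sum_range i.2]
    simp only [inner, mul_comm _ (Sbar _ _)]
    refine (Fin.sum_univ_eq_sum_range
      (fun l => Sbar j l * ∑ k ∈ Finset.range ((i : ℕ) + 1), S i k * 𝓜 k l) n).trans ?_
    rw [h.lower_bar.sum_range j.2, h.sum_mul_sum_eq]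
    simp [Fin.ext_iff]
  have hdet : B.det ≠ 0 := by
    intro h0
    have := congrArg Matrix.det hprod
    rw [Matrix.det_mul, Matrix.det_mul, h0, mul_zero, zero_mul, Matrix.det_diagonal] at this
    exact Finset.prod_ne_zero_iff.2 (fun (i : Fin n) _ => h.diag_ne_zero i) this.symm
  have hv0 : (fun i : Fin n => v i) = 0 := by
    refine Matrix.eq_zero_of_vecMul_eq_zero hdet (funext fun m => ?_)
    have := hv m m.2
    rwa [← Fin.sum_univ_eq_sum_range (fun k => v k * 𝓜 k m) n] at this
  exact fun k hk => congrFun hv0 ⟨k, hk⟩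

end

/-! ### Order of column vectors on the step line -/

section

variable {p : ℕ}

/-- The polynomial `∑_a X^a P_a(X^p)`. It lists the coefficients of the column vector `P` in the
order given by the monomial vectors. -/
noncomputable def flatten (p : ℕ) : (Fin p → ℂ[X]) →ₗ[ℂ] ℂ[X] where
  toFun P := ∑ a : Fin p, X ^ (a : ℕ) * expand ℂ p (P a)
  map_add' P Q := by simp [mul_add, Finset.sum_add_distrib]
  map_smul' c P := by simp [Finset.smul_sum]

theorem flatten_apply (P : Fin p → ℂ[X]) :
    flatten p P = ∑ a : Fin p, X ^ (a : ℕ) * expand ℂ p (P a) := rfl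

/-- The summand of index `a` occupies only the exponents congruent to `a` modulo `p`, so distinct
components never overlap. -/
theorem coeff_flatten (P : Fin p → ℂ[X]) (s : ℕ) (i : Fin p) :
    (flatten p P).coeff (p * s + i) = (P i).coeff s := by
  have hp : 0 < p := i.pos
  rw [flatten_apply, finsetSum_coeff, Finset.sum_eq_single i]
  · rw [coeff_X_pow_mul, coeff_expand_mul' hp]
  · intro b _ hb
    rw [coeff_X_pow_mul']
    split_ifs with h
    · rw [coeff_expand hp, if_neg]
      rintro ⟨c, hc⟩
      apply hb
      have h1 : p * s + i = p * c + b := by omega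
      have h2 := congrArg (· % p) h1
      simp only [Nat.mul_add_mod, Nat.mod_eq_of_lt i.2, Nat.mod_eq_of_lt b.2] at h2
      exact Fin.ext h2.symm
    · rfl
  · simp

theorem flatten_injective : Function.Injective (flatten p) := by
  intro P Q h
  funext i
  ext s
  rw [← coeff_flatten, ← coeff_flatten, h]

theorem flatten_smul (f : ℂ[X]) (P : Fin p → ℂ[X]) :
    flatten p (f • P) = expand ℂ p f * flatten p P := by
  simp only [flatten_apply, Finset.mul_sum, Pi.smul_apply, smul_eq_mul, map_mul]
  exact Finset.sum_congr rfl fun a _ => by ring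

theorem flatten_monomialVec (hp : 0 < p) (m : ℕ) :
    flatten p (fun a => monomialVec p m a) = X ^ m := by
  rw [flatten_apply, Finset.sum_eq_single ⟨m % p, Nat.mod_lt _ hp⟩]
  · simp only [monomialVec, if_true, map_pow, expand_X, ← pow_mul, ← pow_add, Nat.mod_add_div]
  · intro b _ hb
    rw [monomialVec, if_neg, map_zero, mul_zero]
    exact fun h => hb (Fin.ext h.symm)
  · simp

/-- Turns a bound on the degree of `flatten` into membership in the span of the first `n` monomial
columns. -/
theorem eq_sum_monomialVec (hp : 0 < p) {n : ℕ} {P : Fin p → ℂ[X]}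
    (h : (flatten p P).degree < n) :
    P = ∑ m ∈ Finset.range n, (flatten p P).coeff m • fun a => monomialVec p m a := by
  apply flatten_injective
  simp only [map_sum, map_smul, flatten_monomialVec hp]
  ext k
  simp only [finsetSum_coeff, coeff_smul, coeff_X_pow, smul_eq_mul, mul_ite, mul_one, mul_zero,
    Finset.sum_ite_eq, Finset.mem_range]
  split_ifs with hk
  · rfl
  · exact coeff_eq_zero_of_degree_lt (h.trans_le (by exact_mod_cast not_lt.1 hk))

/-- With `m = p l + a`, the product is column `a` of `R` times `X ^ l`. For `a ≥ r` its top entry is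
the diagonal entry of `t_N` in row `a - r`; for `a < r` it is that of `t_{N-1}` in row `a + (p -
r)`. Both sit at position `m + (N p - r)`. -/
theorem HasLeadingForm.degree_flatten_mulVec_monomialVec {N r : ℕ}
    {R : Matrix (Fin p) (Fin p) ℂ[X]} (hR : HasLeadingForm N r R) (hN : 0 < N) (hr : r < p)
    (m : ℕ) : (flatten p (R.mulVec fun a => monomialVec p m a)).degree = (m + (N * p - r) : ℕ) := by
  have hp : 0 < p := by omega
  obtain ⟨N, rfl⟩ : ∃ n, N = n + 1 := ⟨N - 1, by omega⟩
  set a : Fin p := ⟨m % p, Nat.mod_lt _ hp⟩ with ha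
  set l := m / p with hl
  have hm : m = p * l + a := (Nat.div_add_mod m p).symm
  have hrow : ∀ i, R.mulVec (fun a => monomialVec p m a) i = R i a * X ^ l := by
    intro i
    rw [Matrix.mulVec, dotProduct, Finset.sum_eq_single a]
    · simp [monomialVec, a, l]
    · intro b _ hb
      rw [monomialVec, if_neg, mul_zero]
      exact fun h => hb (Fin.ext h.symm)
    · simp
  have hcoeff : ∀ s (i : Fin p), (flatten p (R.mulVec fun a => monomialVec p m a)).coeff
      (p * (s + l) + i) = (R i a).coeff s := by
    intro s i
    rw [coeff_flatten, hrow, coeff_mul_X_pow]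
  have hM : (N + 1) * p - r = p * N + (p - r) := by
    rw [Nat.mul_comm, Nat.mul_add]; omega
  rw [hM]
  refine le_antisymm ((degree_le_iff_coeff_zero _ _).2 fun k hk => ?_) (le_degree_of_ne_zero ?_)
  · have hk' : m + (p * N + (p - r)) < k := by exact_mod_cast hk
    obtain ⟨i, hi⟩ : ∃ i : Fin p, (i : ℕ) = k % p := ⟨⟨k % p, Nat.mod_lt _ hp⟩, rfl⟩
    have hki : p * (k / p) + i = k := by rw [hi]; exact Nat.div_add_mod k p
    have hge : l + N ≤ k / p := by
      rw [Nat.le_div_iff_mul_le hp, Nat.add_mul, Nat.mul_comm l, Nat.mul_comm N]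
      omega
    obtain ⟨e, he⟩ := Nat.exists_eq_add_of_le hge
    have hek : k = p * (N + e + l) + i := by rw [← hki, he]; ring
    rw [hek, hcoeff]
    have hlt : (a : ℕ) + (p - r) < p * e + i := by
      have : p * (N + e + l) = p * N + p * e + p * l := by ring
      omega
    -- After the shift of `N`, the cases concern the subleading coefficient, the leading one, and
    -- those beyond the degree bound.
    rcases e with _ | _ | e
    · simpa using hR.sub_upper i a (by simpa using hlt)
    · exact hR.lead_upper i a (by omega)
    · exact coeff_eq_zero_of_natDegree_lt (lt_of_le_of_lt (hR.natDegree_le i a) (by omega))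
  · by_cases har : (a : ℕ) < r
    · have h1 : m + (p * N + (p - r)) =
          p * (N + l) + ((⟨a + (p - r), by omega⟩ : Fin p) : ℕ) := by
        rw [mul_add]; simp only; omega
      rw [h1, hcoeff]
      simpa using hR.sub_diag ⟨a + (p - r), by omega⟩ a rfl
    · have h1 : m + (p * N + (p - r)) =
          p * (N + 1 + l) + ((⟨a - r, by omega⟩ : Fin p) : ℕ) := by
        rw [mul_add, mul_add]; simp only; omega
      rw [h1, hcoeff]
      exact hR.lead_diag ⟨a - r, by omega⟩ a (by simp only; omega)

/-- Multiplication by `R` shifts the order of a column vector by `N p - r`. -/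
theorem HasLeadingForm.degree_flatten_mulVec {N r : ℕ}
    {R : Matrix (Fin p) (Fin p) ℂ[X]} (hR : HasLeadingForm N r R) (hN : 0 < N) (hr : r < p)
    (P : Fin p → ℂ[X]) :
    (flatten p (R.mulVec P)).degree = (flatten p P).degree + (N * p - r : ℕ) := by
  have hp : 0 < p := by omega
  by_cases h0 : flatten p P = 0
  · have : P = 0 := flatten_injective (by simpa using h0)
    simp [this]
  set f := flatten p P with hf
  set T := (flatten p).comp ((Matrix.mulVecLin R).restrictScalars ℂ) with hT
  have hTm : ∀ m, (T fun a => monomialVec p m a).degree = (m + (N * p - r) : ℕ) :=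
    hR.degree_flatten_mulVec_monomialVec hN hr
  have hP := eq_sum_monomialVec hp (n := f.natDegree + 1) (P := P)
    (by rw [← hf, degree_eq_natDegree h0]; exact_mod_cast Nat.lt_succ_self _)
  have hlead : f.coeff f.natDegree ≠ 0 := by simpa using h0
  have key : flatten p (R.mulVec P) = ∑ m ∈ Finset.range f.natDegree,
      f.coeff m • (T fun a => monomialVec p m a) +
        f.coeff f.natDegree • (T fun a => monomialVec p f.natDegree a) := by
    have : flatten p (R.mulVec P) = T P := rfl
    rw [this, ← Finset.sum_range_succ]
    conv_lhs => rw [hP]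
    simp only [map_sum, map_smul]
    rfl
  have hd : (f.coeff f.natDegree • (T fun a => monomialVec p f.natDegree a)).degree =
      (f.natDegree + (N * p - r) : ℕ) := by
    rw [smul_eq_C_mul, degree_C_mul hlead, hTm]
  -- The images of distinct monomial columns have distinct degrees, so the last one cannot cancel.
  rw [key, degree_add_eq_right_of_degree_lt, hd, degree_eq_natDegree h0]
  · push_cast; rfl
  · rw [hd, ← mem_degreeLT]
    refine Submodule.sum_mem _ fun m hm => Submodule.smul_mem _ _ ?_
    rw [mem_degreeLT, hTm]
    have := Finset.mem_range.1 hm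
    exact_mod_cast Nat.add_lt_add_right this _

end

/-! ### Null vectors at simple zeros of the determinant -/

section

section Adjugate

variable {n K : Type*} [Fintype n] [DecidableEq n] [Field K]

/-- The kernel of a matrix with nonzero adjugate is at most one-dimensional. -/
theorem exists_smul_eq_of_mulVec_eq_zero {A : Matrix n n K} (hA : A.adjugate ≠ 0) {v u : n → K}
    (hv : v ≠ 0) (hAv : A.mulVec v = 0) (hAu : A.mulVec u = 0) : ∃ c : K, u = c • v := by
  obtain ⟨i, j, hij⟩ : ∃ i j, A.adjugate i j ≠ 0 := by
    by_contra! h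
    exact hA (Matrix.ext h)
  rw [Matrix.adjugate_apply] at hij
  -- The nonzero cofactor is the determinant of `A` with row `j` replaced by the `i`-th unit vector;
  -- that matrix kills every null vector of `A` with vanishing `i`-th entry.
  have key : ∀ w : n → K, A.mulVec w = 0 → w i = 0 → w = 0 := by
    intro w hw hwi
    refine Matrix.eq_zero_of_mulVec_eq_zero hij (funext fun k => ?_)
    by_cases hk : k = j
    · subst hk
      simpa [Matrix.mulVec, Matrix.updateRow_self] using hwi
    · simpa [Matrix.mulVec, Matrix.updateRow_ne hk] using congrFun hw k
  have hvi : v i ≠ 0 := fun h => hv (key v hAv h)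
  refine ⟨u i / v i, sub_eq_zero.1 (key _ ?_ ?_)⟩
  · rw [Matrix.mulVec_sub, Matrix.mulVec_smul, hAv, hAu, smul_zero, sub_zero]
  · simp [hvi]

/-- Since `adj(A) A = 0`, each row of the adjugate is a left null vector, hence a multiple of `v`.
-/
theorem adjugate_mulVec_eq_zero {A : Matrix n n K} (hA : A.adjugate ≠ 0) {v w : n → K}
    (hv : v ≠ 0) (hAv : A.vecMul v = 0) (hvw : v ⬝ᵥ w = 0) : A.adjugate.mulVec w = 0 := by
  have hdet : A.det = 0 := Matrix.exists_vecMul_eq_zero_iff.1 ⟨v, hv, hAv⟩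
  funext i
  obtain ⟨c, hc⟩ := exists_smul_eq_of_mulVec_eq_zero (A := A.transpose) (v := v)
    (u := A.adjugate i) (by rwa [← Matrix.adjugate_transpose, Ne, Matrix.transpose_eq_zero]) hv
    (by rwa [Matrix.mulVec_transpose]) (by
      rw [Matrix.mulVec_transpose]
      funext j
      have := congrFun (congrFun (Matrix.adjugate_mul A) i) j
      simpa [hdet, Matrix.mul_apply, Matrix.vecMul, dotProduct] using this)
  rw [Matrix.mulVec, hc, smul_dotProduct, hvw, smul_zero]
  rfl

end Adjugate

variable {p : ℕ}

theorem eval_mulVec (R : Matrix (Fin p) (Fin p) ℂ[X]) (P : Fin p → ℂ[X]) (z : ℂ) :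
    (fun a => (R.mulVec P a).eval z) = (evalAt R z).mulVec fun a => (P a).eval z := by
  funext a
  simp [Matrix.mulVec, dotProduct, eval_finsetSum, evalAt]

theorem det_evalAt (R : Matrix (Fin p) (Fin p) ℂ[X]) (z : ℂ) :
    (evalAt R z).det = R.det.eval z := by
  simpa [evalAt] using! (RingHom.map_det (evalRingHom z) R).symm

theorem adjugate_evalAt (R : Matrix (Fin p) (Fin p) ℂ[X]) (z : ℂ) :
    (evalAt R z).adjugate = evalAt R.adjugate z := by
  simpa [evalAt] using! (RingHom.map_adjugate (evalRingHom z) R).symm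

/-- The column vector `(R(x) - R(z)) v / (x - z)`, for `R(z) v = 0`. -/
noncomputable def eigenQuotient (R : Matrix (Fin p) (Fin p) ℂ[X]) (z : ℂ) (v : Fin p → ℂ)
    (a : Fin p) : ℂ[X] :=
  R.mulVec (fun b => C (v b)) a /ₘ (X - C z)

variable {R : Matrix (Fin p) (Fin p) ℂ[X]} {z : ℂ} {v w : Fin p → ℂ}

theorem smul_eigenQuotient (hv : (evalAt R z).mulVec v = 0) :
    (X - C z) • eigenQuotient R z v = R.mulVec fun b => C (v b) := by
  funext a
  refine mul_divByMonic_eq_iff_isRoot.2 ?_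
  have := congrFun (eval_mulVec R (fun b => C (v b)) z) a
  simp only [eval_C, hv] at this
  exact this

theorem eval_eigenQuotient (hv : (evalAt R z).mulVec v = 0) (y : ℂ) :
    (y - z) • (fun a => (eigenQuotient R z v a).eval y) = (evalAt R y).mulVec v := by
  have := eval_mulVec R (fun b => C (v b)) y
  simp only [eval_C] at this
  rw [← this, ← smul_eigenQuotient hv]
  funext a
  simp

/-- A left null vector at a different point annihilates the eigenvector quotient. -/
theorem dotProduct_eval_eigenQuotient_of_ne (hv : (evalAt R z).mulVec v = 0) {y : ℂ}
    (hy : y ≠ z) (hw : (evalAt R y).vecMul w = 0) :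
    w ⬝ᵥ (fun a => (eigenQuotient R z v a).eval y) = 0 := by
  have h := congrArg (w ⬝ᵥ ·) (eval_eigenQuotient hv y)
  simp only [dotProduct_smul, Matrix.dotProduct_mulVec, hw, zero_dotProduct] at h
  exact (smul_eq_zero.1 h).resolve_left (sub_ne_zero.2 hy)

/-- Differentiate `(x - z) · quotient = R(x) v` at `x = z`. -/
theorem eval_eigenQuotient_self (hv : (evalAt R z).mulVec v = 0) :
    (fun a => (eigenQuotient R z v a).eval z) = (derivAt R z).mulVec v := by
  funext a
  have h := congrArg (fun f => (derivative f).eval z) (congrFun (smul_eigenQuotient hv) a)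
  simpa [Matrix.mulVec, dotProduct, eval_finsetSum, derivAt] using h

/-- Apply `adj(R)` to `(x - z) · quotient = R v` and cancel `x - z`. -/
theorem adjugate_mulVec_eigenQuotient (hv : (evalAt R z).mulVec v = 0) {d : ℂ[X]}
    (hd : R.det = (X - C z) * d) :
    (evalAt R z).adjugate.mulVec (fun a => (eigenQuotient R z v a).eval z) = d.eval z • v := by
  have h : R.adjugate.mulVec (eigenQuotient R z v) = d • fun b => C (v b) := by
    have h1 : (X - C z) • R.adjugate.mulVec (eigenQuotient R z v) =
        (X - C z) • d • fun b => C (v b) := by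
      rw [← Matrix.mulVec_smul, smul_eigenQuotient hv, Matrix.mulVec_mulVec,
        Matrix.adjugate_mul, Matrix.smul_mulVec, Matrix.one_mulVec, hd, mul_smul]
    funext a
    exact mul_left_cancel₀ (X_sub_C_ne_zero z) (congrFun h1 a)
  rw [adjugate_evalAt, ← eval_mulVec, h]
  funext a
  simp

theorem exists_det_eq_mul (hz : R.det.rootMultiplicity z = 1) :
    ∃ d : ℂ[X], R.det = (X - C z) * d ∧ d.eval z ≠ 0 := by
  have h0 : R.det ≠ 0 := fun h => by simp [h] at hz
  obtain ⟨d, hd, hnd⟩ := exists_eq_pow_rootMultiplicity_mul_and_not_dvd _ h0 z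
  rw [hz, pow_one] at hd
  exact ⟨d, hd, fun h => hnd (dvd_iff_isRoot.2 h)⟩

theorem adjugate_evalAt_ne_zero (hz : R.det.rootMultiplicity z = 1) (hv0 : v ≠ 0)
    (hv : (evalAt R z).mulVec v = 0) : (evalAt R z).adjugate ≠ 0 := by
  obtain ⟨d, hd, hdz⟩ := exists_det_eq_mul hz
  intro h
  have := adjugate_mulVec_eigenQuotient hv hd
  rw [h, Matrix.zero_mulVec] at this
  exact smul_ne_zero hdz hv0 this.symm

/-- At a simple zero of `det R`, the left and right null vectors pair nontrivially through
`R'`. -/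
theorem dotProduct_eval_eigenQuotient_ne_zero (hz : R.det.rootMultiplicity z = 1) (hv0 : v ≠ 0)
    (hv : (evalAt R z).mulVec v = 0) (hw0 : w ≠ 0) (hw : (evalAt R z).vecMul w = 0) :
    w ⬝ᵥ (fun a => (eigenQuotient R z v a).eval z) ≠ 0 := by
  obtain ⟨d, hd, hdz⟩ := exists_det_eq_mul hz
  intro h
  have h1 := adjugate_mulVec_eq_zero (adjugate_evalAt_ne_zero hz hv0 hv) hw0 hw h
  rw [adjugate_mulVec_eigenQuotient hv hd] at h1
  exact smul_ne_zero hdz hv0 h1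

/-- If `det R` has only simple zeros, then a column vector annihilated at each zero by the left null
vector there is a multiple of `R`. -/
theorem exists_eq_mulVec {M : ℕ} {x : Fin M → ℂ} (hroots : ∀ z : ℂ, R.det.IsRoot z ↔ ∃ i, x i = z)
    (hsimple : ∀ i, R.det.rootMultiplicity (x i) = 1) {vL vR : Fin M → Fin p → ℂ}
    (hvL : ∀ i, vL i ≠ 0 ∧ (evalAt R (x i)).vecMul (vL i) = 0)
    (hvR : ∀ i, vR i ≠ 0 ∧ (evalAt R (x i)).mulVec (vR i) = 0) {W : Fin p → ℂ[X]}
    (hW : ∀ i, vL i ⬝ᵥ (fun a => (W a).eval (x i)) = 0) : ∃ U : Fin p → ℂ[X], W = R.mulVec U := by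
  have h0 : R.det ≠ 0 := by
    intro h
    -- A zero determinant would have a root at `0`, hence some `x i`; but the zero polynomial has
    -- root multiplicity `0` by convention.
    obtain ⟨i, -⟩ := (hroots 0).1 (by simp [h])
    simpa [h] using hsimple i
  -- As `det R` has simple zeros, divisibility only requires `adj(R) W` to vanish at each of them.
  -- The quotient is the desired `U`, because `R adj(R) = det R`.
  have hdvd : ∀ a, R.det ∣ R.adjugate.mulVec W a := by
    intro a
    by_cases hg : R.adjugate.mulVec W a = 0
    · rw [hg]; exact dvd_zero _
    refine (IsAlgClosed.splits R.det).dvd_of_roots_le_roots h0 ?_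
    refine (Multiset.le_iff_subset ?_).2 fun y hy => ?_
    · refine Multiset.nodup_iff_count_le_one.2 fun y => ?_
      rw [count_roots]
      by_cases hy : R.det.IsRoot y
      · obtain ⟨i, rfl⟩ := (hroots y).1 hy
        exact (hsimple i).le
      · rw [rootMultiplicity_eq_zero hy]; exact zero_le_one
    · obtain ⟨i, rfl⟩ := (hroots y).1 ((mem_roots h0).1 hy)
      refine (mem_roots hg).2 ?_
      have h1 := adjugate_mulVec_eq_zero
        (adjugate_evalAt_ne_zero (hsimple i) (hvR i).1 (hvR i).2) (hvL i).1 (hvL i).2 (hW i)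
      rw [adjugate_evalAt, ← eval_mulVec] at h1
      exact congrFun h1 a
  choose U hU using hdvd
  refine ⟨U, ?_⟩
  have h1 : R.det • W = R.det • R.mulVec U := by
    rw [← Matrix.mulVec_smul]
    have : R.det • U = R.adjugate.mulVec W := funext fun a => (hU a).symm
    rw [this, Matrix.mulVec_mulVec, Matrix.mul_adjugate, Matrix.smul_mulVec, Matrix.one_mulVec]
  funext a
  exact mul_left_cancel₀ h0 (congrFun h1 a)

end

/-! ### Integration against the measures and their perturbation -/

section

/-- A polynomial without zeros on a closed set of reals is bounded away from zero there. -/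
theorem exists_pos_le_norm_eval {K : Set ℝ} (hK : IsClosed K) (D : ℂ[X])
    (hD : ∀ t ∈ K, D.eval (t : ℂ) ≠ 0) : ∃ δ > 0, ∀ t ∈ K, δ ≤ ‖D.eval (t : ℂ)‖ := by
  by_cases h0 : D = 0
  · exact ⟨1, one_pos, fun t ht => absurd (by simp [h0]) (hD t ht)⟩
  have hlin : ∀ y ∈ D.roots, ∃ δ > 0, ∀ t ∈ K, δ ≤ ‖(t : ℂ) - y‖ := by
    intro y hy
    have hy' : D.eval y = 0 := (mem_roots h0).1 hy
    have hcl : IsClosed ((fun t : ℝ => (t : ℂ)) '' K) :=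
      Complex.isometry_ofReal.isClosedEmbedding.isClosedMap K hK
    have hnot : y ∈ ((fun t : ℝ => (t : ℂ)) '' K)ᶜ := by
      rintro ⟨t, ht, rfl⟩
      exact hD t ht hy'
    obtain ⟨δ, hδ, hball⟩ := Metric.isOpen_iff.1 hcl.isOpen_compl y hnot
    refine ⟨δ, hδ, fun t ht => ?_⟩
    by_contra! hlt
    exact hball (show (t : ℂ) ∈ Metric.ball y δ by simpa [dist_eq_norm] using hlt) ⟨t, ht, rfl⟩
  have hprod : ∀ s : Multiset ℂ, (∀ y ∈ s, ∃ δ > 0, ∀ t ∈ K, δ ≤ ‖(t : ℂ) - y‖) →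
      ∃ δ > 0, ∀ t ∈ K, δ ≤ ‖((s.map fun a => X - C a).prod).eval (t : ℂ)‖ := by
    intro s
    induction s using Multiset.induction_on with
    | empty => exact fun _ => ⟨1, one_pos, fun t _ => by simp⟩
    | cons y s ih =>
      intro h
      obtain ⟨δ, hδ, h1⟩ := ih fun a ha => h a (Multiset.mem_cons_of_mem ha)
      obtain ⟨ε, hε, h2⟩ := h y (Multiset.mem_cons_self y s)
      refine ⟨ε * δ, mul_pos hε hδ, fun t ht => ?_⟩
      rw [Multiset.map_cons, Multiset.prod_cons, eval_mul, norm_mul]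
      simpa using mul_le_mul (by simpa using h2 t ht) (h1 t ht) hδ.le (norm_nonneg _)
  obtain ⟨δ, hδ, h1⟩ := hprod D.roots hlin
  refine ⟨‖D.leadingCoeff‖ * δ, mul_pos (norm_pos_iff.2 (leadingCoeff_ne_zero.2 h0)) hδ,
    fun t ht => ?_⟩
  have h2 := congrArg (eval (t : ℂ)) (IsAlgClosed.splits D).eq_prod_roots
  rw [h2, eval_mul, norm_mul, eval_C]
  exact mul_le_mul_of_nonneg_left (h1 t ht) (norm_nonneg _)

variable {p q : ℕ} {μ : Fin q → Fin p → ComplexMeasure ℝ} {b : Fin q} {a : Fin p}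

theorem HasFiniteMoments.integrable_eval (hμ : HasFiniteMoments μ) (b : Fin q) (a : Fin p)
    (f : ℂ[X]) : Integrable (fun t : ℝ => f.eval (t : ℂ)) (μ b a).variation := by
  simp only [eval_eq_sum_range]
  exact integrable_finsetSum _ fun k _ => (hμ b a k).const_mul _

theorem HasFiniteMoments.integrable_eval_mul_inv (hμ : HasFiniteMoments μ) (f D : ℂ[X])
    (hD : ∀ t ∈ (μ b a).variation.support, D.eval (t : ℂ) ≠ 0) :
    Integrable (fun t : ℝ => f.eval (t : ℂ) * (D.eval (t : ℂ))⁻¹) (μ b a).variation := by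
  obtain ⟨δ, hδ, h⟩ := exists_pos_le_norm_eval Measure.isClosed_support D hD
  refine (hμ.integrable_eval b a f).mul_bdd (c := δ⁻¹) ?_ ?_
  · exact (D.continuous.comp Complex.continuous_ofReal).measurable.inv.aestronglyMeasurable
  · filter_upwards [Measure.support_mem_ae (μ := (μ b a).variation)] with t ht
    rw [norm_inv]
    exact inv_anti₀ hδ (h t ht)

theorem integ_congr {f g : ℂ → ℂ} (h : ∀ t ∈ (μ b a).variation.support, f (t : ℂ) = g t) :
    integ μ b a f = integ μ b a g := by
  refine VectorMeasure.integral_congr_ae ?_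
  filter_upwards [Measure.support_mem_ae (μ := (μ b a).variation)] with t ht using h t ht

theorem integ_add {f g : ℂ → ℂ} (hf : Integrable (fun t : ℝ => f t) (μ b a).variation)
    (hg : Integrable (fun t : ℝ => g t) (μ b a).variation) :
    integ μ b a (fun z => f z + g z) = integ μ b a f + integ μ b a g :=
  VectorMeasure.integral_fun_add hf hg

theorem integ_sum {ι : Type*} (s : Finset ι) {f : ι → ℂ → ℂ}
    (hf : ∀ i ∈ s, Integrable (fun t : ℝ => f i t) (μ b a).variation) :
    integ μ b a (fun z => ∑ i ∈ s, f i z) = ∑ i ∈ s, integ μ b a (f i) :=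
  VectorMeasure.integral_finsetSum s hf

theorem integ_const_mul (c : ℂ) (f : ℂ → ℂ) :
    integ μ b a (fun z => c * f z) = c * integ μ b a f := by
  -- The integral is built from a real bilinear product, so complex homogeneity is checked on the
  -- underlying set function.
  simp only [integ, VectorMeasure.integral_eq_setToFun]
  refine setToFun_smul (𝕜 := ℂ) _ (fun c s x => ?_) c _
  rw [transpose_eq_cbmApplyMeasure, cbmApplyMeasure_apply, cbmApplyMeasure_apply]
  simp [mul_assoc]

/-- Integration of polynomials. -/
noncomputable def integPoly (hμ : HasFiniteMoments μ) (b : Fin q) (a : Fin p) : ℂ[X] →ₗ[ℂ] ℂ where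
  toFun f := integ μ b a fun z => f.eval z
  map_add' f g := by
    simp only [eval_add]
    exact integ_add (hμ.integrable_eval b a f) (hμ.integrable_eval b a g)
  map_smul' c f := by
    simp only [eval_smul, smul_eq_mul, RingHom.id_apply]
    exact integ_const_mul c _

variable {R : Matrix (Fin p) (Fin p) ℂ[X]}

theorem inv_evalAt_apply (R : Matrix (Fin p) (Fin p) ℂ[X]) (z : ℂ) (c a : Fin p) :
    (evalAt R z)⁻¹ c a = (R.adjugate c a).eval z * (R.det.eval z)⁻¹ := by
  rw [Matrix.inv_def, Matrix.smul_apply, adjugate_evalAt, det_evalAt, Ring.inverse_eq_inv',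
    smul_eq_mul, mul_comm]
  rfl

theorem HasFiniteMoments.integrable_eval_mul_inv_evalAt (hμ : HasFiniteMoments μ) (c : Fin p)
    (hD : ∀ t ∈ (μ b c).variation.support, R.det.eval (t : ℂ) ≠ 0) (f : ℂ[X]) :
    Integrable (fun t : ℝ => f.eval (t : ℂ) * (evalAt R t)⁻¹ c a) (μ b c).variation := by
  simp only [inv_evalAt_apply, ← mul_assoc, ← eval_mul]
  exact hμ.integrable_eval_mul_inv _ _ hD

/-- Integration of polynomials against the Geronimus perturbation. -/
noncomputable def perturbedPoly {M : ℕ} (hμ : HasFiniteMoments μ)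
    (hD : ∀ b c, ∀ t ∈ (μ b c).variation.support, R.det.eval (t : ℂ) ≠ 0) (x : Fin M → ℂ)
    (vL : Fin M → Fin p → ℂ) (ξ : Fin M → ℂ → Fin q → ℂ) (b : Fin q) (a : Fin p) :
    ℂ[X] →ₗ[ℂ] ℂ where
  toFun f := perturbed μ R x vL ξ b a fun z => f.eval z
  map_add' f g := by
    have h : ∀ c, integ μ b c (fun z => (f + g).eval z * (evalAt R z)⁻¹ c a) =
        integ μ b c (fun z => f.eval z * (evalAt R z)⁻¹ c a) +
          integ μ b c (fun z => g.eval z * (evalAt R z)⁻¹ c a) := fun c => by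
      simp only [eval_add, add_mul]
      exact integ_add (f := fun z => f.eval z * (evalAt R z)⁻¹ c a)
        (g := fun z => g.eval z * (evalAt R z)⁻¹ c a)
        (hμ.integrable_eval_mul_inv_evalAt c (hD b c) f)
        (hμ.integrable_eval_mul_inv_evalAt c (hD b c) g)
    simp only [perturbed, h]
    simp only [eval_add, add_mul, Finset.sum_add_distrib]
    ring
  map_smul' k f := by
    have h : ∀ c, integ μ b c (fun z => (k • f).eval z * (evalAt R z)⁻¹ c a) =
        k * integ μ b c (fun z => f.eval z * (evalAt R z)⁻¹ c a) := fun c => by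
      simp only [eval_smul, smul_eq_mul, mul_assoc]
      exact integ_const_mul k _
    simp only [perturbed, h]
    simp only [eval_smul, smul_eq_mul, RingHom.id_apply, mul_assoc, mul_add, Finset.mul_sum]

/-- The bilinear form `(Q, P) ↦ ∫ Q dL P`. -/
noncomputable def pairing (L : Fin q → Fin p → ℂ[X] →ₗ[ℂ] ℂ) :
    (Fin q → ℂ[X]) →ₗ[ℂ] (Fin p → ℂ[X]) →ₗ[ℂ] ℂ :=
  LinearMap.mk₂ ℂ (fun Q P => ∑ b, ∑ a, L b a (Q b * P a))
    (fun Q Q' P => by simp [add_mul, Finset.sum_add_distrib])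
    (fun c Q P => by simp [Finset.mul_sum])
    (fun Q P P' => by simp [mul_add, Finset.sum_add_distrib])
    (fun c Q P => by simp [Finset.mul_sum])

theorem pairing_apply (L : Fin q → Fin p → ℂ[X] →ₗ[ℂ] ℂ) (Q : Fin q → ℂ[X]) (P : Fin p → ℂ[X]) :
    pairing L Q P = ∑ b, ∑ a, L b a (Q b * P a) := rfl

theorem momentMatrix_integ (hμ : HasFiniteMoments μ) (n m : ℕ) :
    momentMatrix (integ μ) n m =
      pairing (integPoly hμ) (monomialVec q n) (monomialVec p m) := by
  simp [momentMatrix, pairing_apply, integPoly]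

theorem momentMatrix_perturbed {M : ℕ} (hμ : HasFiniteMoments μ)
    (hD : ∀ b c, ∀ t ∈ (μ b c).variation.support, R.det.eval (t : ℂ) ≠ 0) (x : Fin M → ℂ)
    (vL : Fin M → Fin p → ℂ) (ξ : Fin M → ℂ → Fin q → ℂ) (n m : ℕ) :
    momentMatrix (perturbed μ R x vL ξ) n m =
      pairing (perturbedPoly hμ hD x vL ξ) (monomialVec q n) (monomialVec p m) := by
  simp [momentMatrix, pairing_apply, perturbedPoly]

/-- If `P = R g` on the supports, then `∫ Q dμ̌ P` is `∫ Q dμ g` plus the contribution of the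
point masses. -/
theorem pairing_perturbedPoly {M : ℕ} (hμ : HasFiniteMoments μ)
    (hD : ∀ b c, ∀ t ∈ (μ b c).variation.support, R.det.eval (t : ℂ) ≠ 0) (x : Fin M → ℂ)
    (vL : Fin M → Fin p → ℂ) (ξ : Fin M → ℂ → Fin q → ℂ) (Q : Fin q → ℂ[X]) (P : Fin p → ℂ[X])
    (g : Fin p → ℂ → ℂ)
    (hg : ∀ b c, ∀ t ∈ (μ b c).variation.support,
      (fun a => (P a).eval (t : ℂ)) = (evalAt R t).mulVec fun a => g a t) :
    pairing (perturbedPoly hμ hD x vL ξ) Q P =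
      (∑ b, ∑ c, integ μ b c fun z => (Q b).eval z * g c z) +
        ∑ i, (∑ b, (Q b).eval (x i) * ξ i (x i) b) *
          (vL i ⬝ᵥ fun a => (P a).eval (x i)) := by
  have h1 : ∀ b, ∑ a, perturbedPoly hμ hD x vL ξ b a (Q b * P a) =
      (∑ c, integ μ b c fun z => (Q b).eval z * g c z) +
        ∑ i, ((Q b).eval (x i) * ξ i (x i) b) * (vL i ⬝ᵥ fun a => (P a).eval (x i)) := by
    intro b
    have : ∀ a, perturbedPoly hμ hD x vL ξ b a (Q b * P a) =
      perturbed μ R x vL ξ b a fun z => (Q b * P a).eval z := fun _ => rfl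
    simp only [this, perturbed, Finset.sum_add_distrib]
    congr 1
    · rw [Finset.sum_comm]
      refine Finset.sum_congr rfl fun c _ => ?_
      refine (integ_sum (f := fun a z => (Q b * P a).eval z * (evalAt R z)⁻¹ c a) Finset.univ
        fun a _ => hμ.integrable_eval_mul_inv_evalAt c (hD b c) (Q b * P a)).symm.trans ?_
      refine integ_congr fun t ht => ?_
      have h2 : (evalAt R t)⁻¹.mulVec (fun a => (P a).eval (t : ℂ)) = fun a => g a t := by
        rw [hg b c t ht, Matrix.mulVec_mulVec, Matrix.nonsing_inv_mul, Matrix.one_mulVec]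
        rw [det_evalAt]
        exact (hD b c t ht).isUnit
      rw [← congrFun h2 c, Matrix.mulVec, dotProduct, Finset.mul_sum]
      exact Finset.sum_congr rfl fun a _ => by rw [eval_mul]; ring
    · rw [Finset.sum_comm]
      refine Finset.sum_congr rfl fun i _ => ?_
      rw [dotProduct, Finset.mul_sum]
      exact Finset.sum_congr rfl fun a _ => by rw [eval_mul]; ring
  rw [pairing_apply, Finset.sum_congr rfl fun b _ => h1 b, Finset.sum_add_distrib]
  congr 1
  rw [Finset.sum_comm]
  exact Finset.sum_congr rfl fun i _ => (Finset.sum_mul _ _ _).symm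

end

/-! ### Interpolation at the zeros and division by `R` -/

section

variable {p q N r M : ℕ} {R : Matrix (Fin p) (Fin p) ℂ[X]}

theorem degree_flatten_C_lt (v : Fin p → ℂ) : (flatten p fun b => C (v b)).degree < p := by
  rw [flatten_apply, ← mem_degreeLT]
  refine Submodule.sum_mem _ fun a _ => ?_
  rw [mem_degreeLT, expand_C, mul_comm]
  exact (degree_C_mul_X_pow_le _ _).trans_lt (by exact_mod_cast a.2)

/-- Flattening `(X - z) · quotient = R v` turns the scalar factor into `X ^ p - z`, of degree `p`,
while `R v` has order below `p + (N p - r)`. -/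
theorem HasLeadingForm.degree_flatten_eigenQuotient_lt (hR : HasLeadingForm N r R) (hN : 0 < N)
    (hr : r < p) {z : ℂ} {v : Fin p → ℂ} (hv : (evalAt R z).mulVec v = 0) :
    (flatten p (eigenQuotient R z v)).degree < (N * p - r : ℕ) := by
  by_cases h0 : flatten p (eigenQuotient R z v) = 0
  · rw [h0, degree_zero]; exact WithBot.bot_lt_coe _
  have h1 := congrArg (fun P => (flatten p P).degree) (smul_eigenQuotient hv)
  simp only [flatten_smul, hR.degree_flatten_mulVec hN hr, map_sub, expand_X, expand_C,
    degree_mul, degree_X_pow_sub_C (show 0 < p by omega)] at h1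
  have h2 := degree_flatten_C_lt v
  rw [degree_eq_natDegree h0] at h1 ⊢
  by_cases h3 : (flatten p fun b => C (v b)) = 0
  · simp [h3] at h1
  rw [degree_eq_natDegree h3] at h1 h2
  norm_cast at h1 h2 ⊢
  omega

/-- Evaluation of column vectors at the zeros of `det R`, paired with the left null vectors. -/
noncomputable def nullEval (x : Fin M → ℂ) (vL : Fin M → Fin p → ℂ) :
    (Fin p → ℂ[X]) →ₗ[ℂ] (Fin M → ℂ) where
  toFun W i := vL i ⬝ᵥ fun a => (W a).eval (x i)
  map_add' W W' := by
    funext i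
    simp [dotProduct, mul_add, Finset.sum_add_distrib]
  map_smul' c W := by
    funext i
    simp [dotProduct, Finset.mul_sum, mul_left_comm]

theorem nullEval_apply (x : Fin M → ℂ) (vL : Fin M → Fin p → ℂ) (W : Fin p → ℂ[X]) (i : Fin M) :
    nullEval x vL W i = vL i ⬝ᵥ fun a => (W a).eval (x i) := rfl

/-- The zeros of `det R` are simple, with left and right null vectors `vL`, `vR`. -/
structure SimpleNullData (R : Matrix (Fin p) (Fin p) ℂ[X]) (x : Fin M → ℂ)
    (vL vR : Fin M → Fin p → ℂ) : Prop where
  injective : Function.Injective x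
  isRoot_iff : ∀ z : ℂ, R.det.IsRoot z ↔ ∃ i, x i = z
  simple : ∀ i, R.det.rootMultiplicity (x i) = 1
  left : ∀ i, vL i ≠ 0 ∧ (evalAt R (x i)).vecMul (vL i) = 0
  right : ∀ i, vR i ≠ 0 ∧ (evalAt R (x i)).mulVec (vR i) = 0

variable {x : Fin M → ℂ} {vL vR : Fin M → Fin p → ℂ}

/-- The matrix of values of `nullEval` on the quotients is diagonal with nonzero diagonal, so
interpolation is explicit. -/
theorem SimpleNullData.exists_nullEval_sum_eq (h : SimpleNullData R x vL vR) (y : Fin M → ℂ) :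
    ∃ c : Fin M → ℂ, nullEval x vL (∑ i, c i • eigenQuotient R (x i) (vR i)) = y := by
  refine ⟨fun i => y i / (vL i ⬝ᵥ fun a => (eigenQuotient R (x i) (vR i) a).eval (x i)), ?_⟩
  funext j
  rw [map_sum, Finset.sum_apply, Finset.sum_eq_single j]
  · rw [map_smul, Pi.smul_apply, nullEval_apply, smul_eq_mul]
    exact div_mul_cancel₀ _ (dotProduct_eval_eigenQuotient_ne_zero (h.simple j) (h.right j).1
      (h.right j).2 (h.left j).1 (h.left j).2)
  · intro i _ hij
    rw [map_smul, Pi.smul_apply, nullEval_apply, dotProduct_eval_eigenQuotient_of_ne (h.right i).2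
      (fun h' => hij (h.injective h').symm) (h.left j).2, smul_zero]
  · simp

theorem SimpleNullData.exists_eq_mulVec (h : SimpleNullData R x vL vR) {W : Fin p → ℂ[X]}
    (hW : nullEval x vL W = 0) : ∃ U : Fin p → ℂ[X], W = R.mulVec U :=
  MixedOP.exists_eq_mulVec h.isRoot_iff h.simple h.left h.right fun i => congrFun hW i

theorem HasLeadingForm.degree_flatten_sum_eigenQuotient_lt (hR : HasLeadingForm N r R) (hN : 0 < N)
    (hr : r < p) (h : SimpleNullData R x vL vR) (c : Fin M → ℂ) :
    (flatten p (∑ i, c i • eigenQuotient R (x i) (vR i))).degree < (N * p - r : ℕ) := by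
  rw [map_sum, ← mem_degreeLT]
  refine Submodule.sum_mem _ fun i _ => ?_
  rw [map_smul]
  exact Submodule.smul_mem _ _
    (mem_degreeLT.2 (hR.degree_flatten_eigenQuotient_lt hN hr (h.right i).2))

/-- The number of zeros of `det R` is `N p - r`. -/
theorem HasLeadingForm.card_eq (hR : HasLeadingForm N r R) (hN : 0 < N) (hr : r < p)
    (h : SimpleNullData R x vL vR) : M = N * p - r := by
  have hp : 0 < p := by omega
  set K := N * p - r with hK
  set T : (Fin K → ℂ) →ₗ[ℂ] (Fin M → ℂ) := (nullEval x vL).comp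
    (Fintype.linearCombination ℂ fun m : Fin K => fun a => monomialVec p m a) with hT
  have hT_apply : ∀ c, T c = nullEval x vL (∑ m : Fin K, c m • fun a => monomialVec p m a) :=
    fun c => by rw [hT, LinearMap.comp_apply, Fintype.linearCombination_apply]
  -- A vector in the kernel is some `R U`, of order at least `K` unless `U = 0`.
  have hinj : Function.Injective T := by
    rw [← LinearMap.ker_eq_bot, LinearMap.ker_eq_bot']
    intro c hc
    rw [hT_apply] at hc
    obtain ⟨U, hU⟩ := h.exists_eq_mulVec hc
    have hflat : flatten p (∑ m : Fin K, c m • fun a => monomialVec p m a) =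
        ∑ m : Fin K, c m • X ^ (m : ℕ) := by
      simp only [map_sum, map_smul, flatten_monomialVec hp]
    have hlt : (∑ m : Fin K, c m • (X : ℂ[X]) ^ (m : ℕ)).degree < K := by
      rw [← mem_degreeLT]
      refine Submodule.sum_mem _ fun m _ => Submodule.smul_mem _ _ ?_
      rw [mem_degreeLT, degree_X_pow]
      exact_mod_cast m.2
    rw [← hflat, hU, hR.degree_flatten_mulVec hN hr, ← hK] at hlt
    have hU0 : flatten p U = 0 := by
      by_contra h0
      rw [degree_eq_natDegree h0] at hlt
      norm_cast at hlt
      omega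
    have hU0' : U = 0 := flatten_injective (by rw [hU0, map_zero])
    rw [hU, hU0', Matrix.mulVec_zero, map_zero] at hflat
    funext m
    have := congrArg (fun f => f.coeff (m : ℕ)) hflat
    simpa [finsetSum_coeff, coeff_X_pow, Fin.val_inj] using this.symm
  -- The interpolating quotients already have order `< K`.
  have hsurj : Function.Surjective T := by
    intro y
    obtain ⟨c, hc⟩ := h.exists_nullEval_sum_eq y
    have hsum := eq_sum_monomialVec hp (hR.degree_flatten_sum_eigenQuotient_lt hN hr h c)
    rw [hsum, ← hK, ← Fin.sum_univ_eq_sum_range (fun m =>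
      (flatten p (∑ i, c i • eigenQuotient R (x i) (vR i))).coeff m •
        fun a => monomialVec p m a) K] at hc
    exact ⟨_, (hT_apply _).trans hc⟩
  have := (LinearEquiv.ofBijective T ⟨hinj, hsurj⟩).finrank_eq
  simpa using this.symm

/-- Column vectors of order `< n` decompose into a multiple of `R` of the complementary order and a
combination of eigenvector quotients. -/
theorem HasLeadingForm.exists_eq_mulVec_add_sum (hR : HasLeadingForm N r R) (hN : 0 < N)
    (hr : r < p) (h : SimpleNullData R x vL vR) {n : ℕ} (hn : M ≤ n) {P : Fin p → ℂ[X]}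
    (hP : (flatten p P).degree < n) :
    ∃ (U : Fin p → ℂ[X]) (c : Fin M → ℂ), (flatten p U).degree < (n - M : ℕ) ∧
      P = R.mulVec U + ∑ i, c i • eigenQuotient R (x i) (vR i) := by
  have hM := hR.card_eq hN hr h
  obtain ⟨c, hc⟩ := h.exists_nullEval_sum_eq (nullEval x vL P)
  obtain ⟨U, hU⟩ := h.exists_eq_mulVec
    (W := P - ∑ i, c i • eigenQuotient R (x i) (vR i)) (by rw [map_sub, hc, sub_self])
  refine ⟨U, c, ?_, by rw [← hU, sub_add_cancel]⟩
  have hd : (flatten p (R.mulVec U)).degree < n := by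
    rw [← hU, map_sub, ← mem_degreeLT]
    refine Submodule.sub_mem _ (mem_degreeLT.2 hP) (mem_degreeLT.2 ?_)
    refine (hR.degree_flatten_sum_eigenQuotient_lt hN hr h c).trans_le ?_
    rw [← hM]
    exact_mod_cast hn
  rw [hR.degree_flatten_mulVec hN hr, ← hM] at hd
  by_cases h0 : flatten p U = 0
  · rw [h0, degree_zero]; exact WithBot.bot_lt_coe _
  rw [degree_eq_natDegree h0] at hd ⊢
  norm_cast at hd ⊢
  omega

end

/-! ### The perturbed form on multiples of `R` and on quotients -/

section

variable {p q N r M : ℕ} {R : Matrix (Fin p) (Fin p) ℂ[X]} {x : Fin M → ℂ}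
  {vL vR : Fin M → Fin p → ℂ} {μ : Fin q → Fin p → ComplexMeasure ℝ}

theorem polyB_eq_sum (S : Matrix ℕ ℕ ℂ) (n : ℕ) :
    polyB q S n = ∑ k ∈ Finset.range (n + 1), S n k • monomialVec q k := by
  funext b
  simp [polyB, smul_eq_C_mul]

theorem IsLowerUnitriangular.polyB_eq_sum_range {S : Matrix ℕ ℕ ℂ} (hS : IsLowerUnitriangular S)
    {i n : ℕ} (hi : i < n) : polyB q S i = ∑ k ∈ Finset.range n, S i k • monomialVec q k := by
  rw [polyB_eq_sum]
  refine Finset.sum_subset (Finset.range_subset_range.2 hi) fun k _ hk => ?_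
  rw [hS.2 i k (by simpa using hk), zero_smul]

/-- Orthogonality of `B_n` to the column vectors of order `< n`. -/
theorem IsGaussBorel.pairing_polyB_eq_zero (hp : 0 < p) {S Sbar : Matrix ℕ ℕ ℂ} {H : ℕ → ℂ}
    (hμ : HasFiniteMoments μ) (h : IsGaussBorel (momentMatrix (integ μ)) S H Sbar) {n k : ℕ}
    (hk : k ≤ n) {U : Fin p → ℂ[X]} (hU : (flatten p U).degree < k) :
    pairing (integPoly hμ) (polyB q S n) U = 0 := by
  rw [eq_sum_monomialVec hp hU, map_sum]
  refine Finset.sum_eq_zero fun m hm => ?_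
  rw [map_smul, polyB_eq_sum, map_sum, LinearMap.sum_apply]
  simp only [map_smul, LinearMap.smul_apply]
  have := h.sum_row_eq_zero m ((Finset.mem_range.1 hm).trans_le hk)
  simp only [momentMatrix_integ hμ] at this
  simp only [smul_eq_mul]
  rw [this, mul_zero]

theorem pairing_perturbedPoly_mulVec (hμ : HasFiniteMoments μ)
    (hD : ∀ b c, ∀ t ∈ (μ b c).variation.support, R.det.eval (t : ℂ) ≠ 0)
    (h : SimpleNullData R x vL vR) (ξ : Fin M → ℂ → Fin q → ℂ) (Q : Fin q → ℂ[X])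
    (U : Fin p → ℂ[X]) :
    pairing (perturbedPoly hμ hD x vL ξ) Q (R.mulVec U) = pairing (integPoly hμ) Q U := by
  rw [pairing_perturbedPoly hμ hD x vL ξ Q _ (fun a z => (U a).eval z)
    fun b c t _ => eval_mulVec R U t]
  have h0 : ∀ i, (vL i ⬝ᵥ fun a => (R.mulVec U a).eval (x i)) = 0 := fun i => by
    rw [eval_mulVec, Matrix.dotProduct_mulVec, (h.left i).2, zero_dotProduct]
  simp only [h0, mul_zero, Finset.sum_const_zero, add_zero, pairing_apply]
  refine Finset.sum_congr rfl fun b _ => Finset.sum_congr rfl fun c _ => ?_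
  simp [integPoly]

/-- On the supports `R⁻¹` sends the quotient to `v_i^R / (t - x_i)`, which produces the Cauchy
transform with a minus sign. Of the point masses only the one at `x_i` survives, where the quotient
equals `R'(x_i) v_i^R`. -/
theorem pairing_perturbedPoly_eigenQuotient (hμ : HasFiniteMoments μ)
    (hD : ∀ b c, ∀ t ∈ (μ b c).variation.support, R.det.eval (t : ℂ) ≠ 0)
    (hsupp : ∀ i b a, ∀ t ∈ (μ b a).variation.support, x i ≠ (t : ℂ))
    (h : SimpleNullData R x vL vR) (ξ : Fin M → ℂ → Fin q → ℂ) (S : Matrix ℕ ℕ ℂ) (n : ℕ)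
    (i : Fin M) :
    pairing (perturbedPoly hμ hD x vL ξ) (polyB q S n) (eigenQuotient R (x i) (vR i)) =
      -(bbD μ S x vR n i - bbW S R x vL vR ξ n i) := by
  rw [pairing_perturbedPoly hμ hD x vL ξ _ _ (fun a z => -vR i a * (x i - z)⁻¹)]
  · rw [neg_sub', sub_eq_add_neg, neg_neg]
    congr 1
    · simp only [bbD, cauchyD, ← Finset.sum_neg_distrib, Finset.sum_mul]
      rw [Finset.sum_comm]
      refine Finset.sum_congr rfl fun a _ => Finset.sum_congr rfl fun b _ => ?_
      rw [mul_comm, ← neg_mul, ← integ_const_mul]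
      exact congrArg _ (funext fun z => by ring)
    · rw [Finset.sum_eq_single i]
      · rw [eval_eigenQuotient_self (h.right i).2, bbW, Finset.sum_mul]
      · intro j _ hj
        rw [dotProduct_eval_eigenQuotient_of_ne (h.right i).2
          (fun h' => hj (h.injective h')) (h.left j).2, mul_zero]
      · simp
  · intro b c t ht
    have hne : x i - t ≠ 0 := sub_ne_zero.2 (hsupp i b c t ht)
    have h1 : (fun a => -vR i a * (x i - (t : ℂ))⁻¹) = ((t : ℂ) - x i)⁻¹ • vR i := by
      funext a
      rw [Pi.smul_apply, smul_eq_mul, ← neg_sub (x i), inv_neg]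
      ring
    rw [h1, Matrix.mulVec_smul, ← eval_eigenQuotient (h.right i).2, smul_smul, inv_mul_cancel₀,
      one_smul]
    rwa [← neg_sub, neg_ne_zero]

end

end MixedOP

/-! ### Nonvanishing of `tau` -/

theorem mainTheorem2 (p q N r M : ℕ) (hp : 0 < p) (hq : 0 < q) (hN : 0 < N) (hr : r < p)
    (μ : Fin q → Fin p → MeasureTheory.ComplexMeasure ℝ) (hμ : MixedOP.HasFiniteMoments μ)
    (R : Matrix (Fin p) (Fin p) (Polynomial ℂ)) (hR : MixedOP.HasLeadingForm N r R)
    (x : Fin M → ℂ) (hx : Function.Injective x)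
    (hroots : ∀ z : ℂ, R.det.IsRoot z ↔ ∃ i, x i = z)
    (hsimple : ∀ i, R.det.rootMultiplicity (x i) = 1)
    (hsupp : ∀ i b a, ∀ t ∈ (μ b a).variation.support, x i ≠ (t : ℂ))
    (vL vR : Fin M → Fin p → ℂ)
    (hvL : ∀ i, vL i ≠ 0 ∧ Matrix.vecMul (vL i) (MixedOP.evalAt R (x i)) = 0)
    (hvR : ∀ i, vR i ≠ 0 ∧ Matrix.mulVec (MixedOP.evalAt R (x i)) (vR i) = 0)
    (ξ : Fin M → ℂ → Fin q → ℂ)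
    (S : Matrix ℕ ℕ ℂ) (H : ℕ → ℂ) (Sbar : Matrix ℕ ℕ ℂ)
    (horth : MixedOP.IsGaussBorel (MixedOP.momentMatrix (MixedOP.integ μ)) S H Sbar)
    (hpert : MixedOP.OrthogonalityExists (MixedOP.perturbed μ R x vL ξ))
    (n : ℕ) (hn : M ≤ n + 1) :
    MixedOP.tau μ S R x vL vR ξ n ≠ 0 := by
  have hdata : MixedOP.SimpleNullData R x vL vR := ⟨hx, hroots, hsimple, hvL, hvR⟩
  have hD : ∀ b c, ∀ t ∈ (μ b c).variation.support, R.det.eval (t : ℂ) ≠ 0 := by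
    intro b c t ht h0
    obtain ⟨i, hi⟩ := (hroots t).1 h0
    exact hsupp i b c t ht hi
  intro hτ
  obtain ⟨c, hc0, hc⟩ := Matrix.exists_vecMul_eq_zero_iff.2 hτ
  set F := MixedOP.pairing (MixedOP.perturbedPoly hμ hD x vL ξ) with hF
  set Q : Fin q → Polynomial ℂ := ∑ k, c k • MixedOP.polyB q S (n + 1 - M + k) with hQ
  have hQeig : ∀ i, F Q (MixedOP.eigenQuotient R (x i) (vR i)) = 0 := by
    intro i
    have hi := congrFun hc i
    simp only [Matrix.vecMul, dotProduct, Matrix.of_apply, Pi.zero_apply] at hi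
    simp only [hQ, map_sum, map_smul, LinearMap.sum_apply, LinearMap.smul_apply, hF,
      MixedOP.pairing_perturbedPoly_eigenQuotient hμ hD hsupp hdata, smul_eq_mul, mul_neg,
      Finset.sum_neg_distrib]
    rw [hi, neg_zero]
  have hQmul : ∀ U : Fin p → Polynomial ℂ, (MixedOP.flatten p U).degree < (n + 1 - M : ℕ) →
      F Q (R.mulVec U) = 0 := by
    intro U hU
    rw [hF, MixedOP.pairing_perturbedPoly_mulVec hμ hD hdata, hQ, map_sum, LinearMap.sum_apply]
    refine Finset.sum_eq_zero fun k _ => ?_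
    rw [map_smul, LinearMap.smul_apply,
      horth.pairing_polyB_eq_zero hp hμ (Nat.le_add_right _ _) hU, smul_zero]
  have hQzero : ∀ m < n + 1, F Q (MixedOP.monomialVec p m) = 0 := by
    intro m hm
    obtain ⟨U, d, hU, hP⟩ := hR.exists_eq_mulVec_add_sum hN hr hdata hn
      (P := fun a => MixedOP.monomialVec p m a) (by
        rw [MixedOP.flatten_monomialVec hp, Polynomial.degree_X_pow]; exact_mod_cast hm)
    have hP' : MixedOP.monomialVec p m = _ := hP
    rw [hP', map_add, hQmul U hU, map_sum, zero_add]
    exact Finset.sum_eq_zero fun i _ => by rw [map_smul, hQeig, smul_zero]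
  -- The coefficients of `Q` in the monomial rows of index at most `n`.
  set v : ℕ → ℂ := fun j => ∑ k : Fin M, c k * S (n + 1 - M + k) j with hv
  have hQv : Q = ∑ j ∈ Finset.range (n + 1), v j • MixedOP.monomialVec q j := by
    simp only [hQ, hv, Finset.sum_smul]
    rw [Finset.sum_comm]
    refine Finset.sum_congr rfl fun k _ => ?_
    rw [horth.lower.polyB_eq_sum_range (show n + 1 - M + k < n + 1 by omega), Finset.smul_sum]
    exact Finset.sum_congr rfl fun j _ => smul_smul _ _ _
  obtain ⟨S', H', Sbar', hpert'⟩ := hpert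
  have hv0 := hpert'.eq_zero_of_sum_eq_zero (n := n + 1) (v := v) (by
    intro m hm
    have := hQzero m hm
    rw [hQv, map_sum, LinearMap.sum_apply] at this
    simpa only [map_smul, LinearMap.smul_apply, smul_eq_mul, hF,
      ← MixedOP.momentMatrix_perturbed] using this)
  -- The last `M` coefficients of `Q` are `c` times a diagonal block of `S`, which is unitriangular.
  refine hc0 (Matrix.eq_zero_of_vecMul_eq_zero
    (M := Matrix.of fun i j : Fin M => S (n + 1 - M + i) (n + 1 - M + j)) ?_ (funext fun j => ?_))
  · rw [horth.lower.det_submatrix]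
    exact one_ne_zero
  · exact hv0 (n + 1 - M + j) (by omega)
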